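/- Let $X$ be a compact metric space and let $G$ be a group acting on $X$ by homeomorphisms. For a Borel measure $\nu$ on $X$ and $g\in G$ let $g\nu$ denote the push-forward of $\nu$ under $x\mapsto gx$, and let $\|\cdot\|$ denote the total variation norm on finite signed Borel measures on $X$, $\|\sigma\| = \sigma^+(X)+\sigma^-(X)$, where $\sigma=\sigma^+-\sigma^-$ is the Jordan decomposition. Let $0<\delta<1$ and let $\alpha$ be a Borel probability measure on $X$ such that $$\|g\alpha-\alpha\|\le \frac{\delta}{10}\qquad\text{for all } g\in G .$$ Then there exists a nonzero finite (positive) Borel measure $\mu_0$ on $X$ which is $G$-invariant, i.e. $g\mu_0=\mu_0$ for all $g\in G$, and satisfies $\|\alpha-\mu_0\|\le\delta$. -/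

import Mathlib

/-- The total variation norm `‖s‖ = |s|(X) = s⁺(X) + s⁻(X)` of a (finite) signed measure `s`,
where `s = s⁺ - s⁻` is the Jordan decomposition. -/
noncomputable def tvNorm {X : Type*} [MeasurableSpace X]
    (s : MeasureTheory.SignedMeasure X) : ℝ :=
  s.totalVariation.real Set.univ

/-! An invariant measure comes from a fixed point of isometries of a Hilbert space. The translates
of `α` stay close in `L¹`, but `L¹` has no point of least norm, and the action on densities is not
isometric in `L²`. Both problems vanish once each density is replaced by the indicator of its
subgraph in `X × ℝ`. For a finite quasi-invariant measure `lam` dominating all translates, the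
Maharam extension preserves `lam × dt` and permutes these subgraphs, while the `L¹` distance of two
indicators is at most the total variation distance of the measures.

The least-norm point `c` of the closed convex hull of the indicators in `L²` is then fixed, and it
stays in the `L¹` ball around the indicator of `α`, that ball being convex and `L²`-closed.
Projecting the positive part of `c` to `X` gives the invariant measure, within `δ / 10` of `α`.

Building `lam` needs a countable group. The general case follows because `C(X, X)` is separable and
preserving a finite measure is a closed condition. -/

open MeasureTheory Filter Set Topology

open scoped ENNReal

/-! ### Total variation through Hahn sets -/

section TotalVariation

variable {X : Type*} [MeasurableSpace X]

/-- The total variation norm of a signed measure is `s i - s iᶜ` for a Hahn set `i`. -/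
theorem exists_tvNorm_eq_sub (s : SignedMeasure X) :
    ∃ i, MeasurableSet i ∧ 0 ≤[i] s ∧ s ≤[iᶜ] 0 ∧ tvNorm s = s i - s iᶜ := by
  obtain ⟨i, hi, hp, hn, h1, h2⟩ := s.toJordanDecomposition_spec
  refine ⟨i, hi, hp, hn, ?_⟩
  have e1 : (s.toMeasureOfZeroLE i hi hp).real univ = s i := by
    rw [SignedMeasure.toMeasureOfZeroLE_real_apply _ _ _ MeasurableSet.univ, inter_univ]
  have e2 : (s.toMeasureOfLEZero iᶜ hi.compl hn).real univ = - s iᶜ := by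
    rw [SignedMeasure.toMeasureOfLEZero_real_apply _ _ _ MeasurableSet.univ, inter_univ]
  rw [tvNorm, SignedMeasure.totalVariation, measureReal_add_apply, h1, h2, e1, e2]
  ring

/-- Cutting along a Hahn set, the parts of `jᶜ` in the positive set and of `j` in the negative set
can only lower the left side. -/
theorem sub_compl_le_tvNorm (s : SignedMeasure X) {j : Set X} (hj : MeasurableSet j) :
    s j - s jᶜ ≤ tvNorm s := by
  obtain ⟨i, hi, hp, hn, h⟩ := exists_tvNorm_eq_sub s
  have pos : ∀ k, MeasurableSet k → k ⊆ i → 0 ≤ s k := fun k _ hki => by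
    simpa using VectorMeasure.subset_le_of_restrict_le_restrict _ _ hi hp hki
  have neg : ∀ k, MeasurableSet k → k ⊆ iᶜ → s k ≤ 0 := fun k _ hki => by
    simpa using VectorMeasure.subset_le_of_restrict_le_restrict _ _ hi.compl hn hki
  have split : ∀ a b : Set X, MeasurableSet a → MeasurableSet b →
      s a = s (a ∩ b) + s (a ∩ bᶜ) := fun a b ha hb => by
    rw [← VectorMeasure.of_union (disjoint_compl_right.mono inter_subset_right inter_subset_right)
      (ha.inter hb) (ha.inter hb.compl), inter_union_compl]
  rw [h, split j i hj hi, split jᶜ i hj.compl hi, split i j hi hj, split iᶜ j hi.compl hj,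
    inter_comm i j, inter_comm i jᶜ, inter_comm iᶜ j, inter_comm iᶜ jᶜ]
  have a1 := pos _ (hj.compl.inter hi) inter_subset_right
  have a2 := neg _ (hj.inter hi.compl) inter_subset_right
  linarith

theorem tvNorm_sub_le {μ ν : Measure X} [IsFiniteMeasure μ] [IsFiniteMeasure ν] {r : ℝ}
    (h : ∀ i, MeasurableSet i → μ.real i - ν.real i + (ν.real iᶜ - μ.real iᶜ) ≤ r) :
    tvNorm (μ.toSignedMeasure - ν.toSignedMeasure) ≤ r := by
  obtain ⟨i, hi, -, -, e⟩ := exists_tvNorm_eq_sub (μ.toSignedMeasure - ν.toSignedMeasure)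
  have := h i hi
  rw [e, sub_apply, sub_apply,
    Measure.toSignedMeasure_apply_measurable hi, Measure.toSignedMeasure_apply_measurable hi,
    Measure.toSignedMeasure_apply_measurable hi.compl,
    Measure.toSignedMeasure_apply_measurable hi.compl]
  linarith

theorem sub_add_sub_compl_le_tvNorm (μ ν : Measure X) [IsFiniteMeasure μ] [IsFiniteMeasure ν]
    {i : Set X} (hi : MeasurableSet i) :
    μ.real i - ν.real i + (ν.real iᶜ - μ.real iᶜ) ≤
      tvNorm (μ.toSignedMeasure - ν.toSignedMeasure) := by
  have := sub_compl_le_tvNorm (μ.toSignedMeasure - ν.toSignedMeasure) hi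
  rw [sub_apply, sub_apply,
    Measure.toSignedMeasure_apply_measurable hi, Measure.toSignedMeasure_apply_measurable hi,
    Measure.toSignedMeasure_apply_measurable hi.compl,
    Measure.toSignedMeasure_apply_measurable hi.compl] at this
  linarith

end TotalVariation

/-! ### Fixed points and `L¹` balls in Hilbert space -/

/-- The point of least norm in the closed convex hull of a set `O` is fixed by every linear
isometry mapping `O` into itself. -/
theorem exists_mem_closure_convexHull_fixed {E : Type*} [NormedAddCommGroup E]
    [InnerProductSpace ℝ E] [CompleteSpace E] {O : Set E} (hO : O.Nonempty) :
    ∃ c ∈ closure (convexHull ℝ O), ∀ T : E →ₗᵢ[ℝ] E, MapsTo T O O → T c = c := by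
  have hconv : Convex ℝ (closure (convexHull ℝ O)) := (convex_convexHull ℝ O).closure
  obtain ⟨c, hc, hmin⟩ := exists_norm_eq_iInf_of_complete_convex
    (hO.convexHull (𝕜 := ℝ)).closure isClosed_closure.isComplete hconv 0
  refine ⟨c, hc, fun T hT => ?_⟩
  rw [norm_eq_iInf_iff_real_inner_le_zero hconv hc] at hmin
  have hTc : T c ∈ closure (convexHull ℝ O) := by
    have h1 : MapsTo T (convexHull ℝ O) (convexHull ℝ O) :=
      convexHull_min (fun x hx => subset_convexHull ℝ O (hT hx))
        ((convex_convexHull ℝ O).linear_preimage T.toLinearMap)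
    exact h1.closure T.continuous hc
  have h := hmin _ hTc
  -- Minimality tested at `T c` reads `‖c‖² ≤ ⟪c, T c⟫`; with `‖T c‖ = ‖c‖` this forces `T c = c`.
  rw [zero_sub, inner_neg_left, inner_sub_right, real_inner_self_eq_norm_sq] at h
  have h2 : ‖T c - c‖ ^ 2 = ‖T c‖ ^ 2 - 2 * inner ℝ (T c) c + ‖c‖ ^ 2 := norm_sub_sq_real _ _
  rw [T.norm_map, real_inner_comm] at h2
  have h3 : ‖T c - c‖ ^ 2 ≤ 0 := by linarith
  have h4 : ‖T c - c‖ = 0 := by nlinarith [norm_nonneg (T c - c)]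
  exact sub_eq_zero.1 (norm_eq_zero.1 h4)

/-- Closed balls of the `L¹` distance are closed and convex in `L²`. -/
theorem eLpNorm_one_sub_le_of_mem_closure_convexHull {Y : Type*} [MeasurableSpace Y]
    {m : Measure Y} {O : Set (Lp ℝ 2 m)} {a c : Lp ℝ 2 m} {r : ℝ≥0∞}
    (hO : ∀ u ∈ O, eLpNorm (u - a : Lp ℝ 2 m) 1 m ≤ r) (hc : c ∈ closure (convexHull ℝ O)) :
    eLpNorm (c - a : Lp ℝ 2 m) 1 m ≤ r := by
  have hconv : Convex ℝ {u : Lp ℝ 2 m | eLpNorm (u - a : Lp ℝ 2 m) 1 m ≤ r} := by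
    intro u hu v hv s t hs ht hst
    have e : s • u + t • v - a = s • (u - a) + t • (v - a) := by
      rw [smul_sub, smul_sub, sub_add_sub_comm, ← add_smul, hst, one_smul]
    have e2 : eLpNorm (s • u + t • v - a : Lp ℝ 2 m) 1 m
        = eLpNorm (s • ((u - a : Lp ℝ 2 m) : Y → ℝ) + t • ((v - a : Lp ℝ 2 m) : Y → ℝ)) 1 m := by
      rw [e]
      apply eLpNorm_congr_ae
      filter_upwards [Lp.coeFn_add (s • (u - a)) (t • (v - a)), Lp.coeFn_smul s (u - a),
        Lp.coeFn_smul t (v - a)] with y h1 h2 h3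
      rw [h1, Pi.add_apply, Pi.add_apply, h2, h3]
    rw [mem_ofPred_eq, e2]
    refine (eLpNorm_add_le ((Lp.aestronglyMeasurable _).const_smul s)
      ((Lp.aestronglyMeasurable _).const_smul t) le_rfl).trans ?_
    rw [eLpNorm_const_smul, eLpNorm_const_smul]
    calc ‖s‖ₑ * _ + ‖t‖ₑ * _ ≤ ‖s‖ₑ * r + ‖t‖ₑ * r := by gcongr <;> assumption
      _ = r := by
        rw [← add_mul, Real.enorm_of_nonneg hs, Real.enorm_of_nonneg ht,
          ← ENNReal.ofReal_add hs ht, hst, ENNReal.ofReal_one, one_mul]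
  have hsub := convexHull_min (𝕜 := ℝ) (s := O) hO hconv
  obtain ⟨u, hu, hlim⟩ := mem_closure_iff_seq_limit.1 hc
  have hlim' : Tendsto (fun n => u n - a) atTop (𝓝 (c - a)) := hlim.sub_const a
  -- `L²` convergence need not give `L¹` convergence, so closedness comes from Fatou along an a.e.
  -- convergent subsequence.
  obtain ⟨ns, -, hns⟩ := (tendstoInMeasure_of_tendsto_Lp hlim').exists_seq_tendsto_ae
  refine (Lp.eLpNorm_lim_le_liminf_eLpNorm
    (fun n => Lp.aestronglyMeasurable (u (ns n) - a)) _ hns).trans ?_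
  exact liminf_le_of_le (by isBoundedDefault) fun b hb => by
    obtain ⟨n, hn⟩ := hb.exists
    exact hn.trans (hsub (hu (ns n)))

/-! ### Subgraphs of densities -/

section Subgraph

variable {X : Type*} [MeasurableSpace X]

/-- The region between `0` and the graph of `f`. -/
def subgraph (f : X → ℝ≥0∞) : Set (X × ℝ) := {p | 0 ≤ p.2 ∧ ENNReal.ofReal p.2 < f p.1}

theorem measurableSet_subgraph {f : X → ℝ≥0∞} (hf : Measurable f) :
    MeasurableSet (subgraph f) :=
  (measurableSet_le measurable_const measurable_snd).inter
    (measurableSet_lt (ENNReal.measurable_ofReal.comp measurable_snd) (hf.comp measurable_fst))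

theorem volume_setOf_ofReal_lt (a : ℝ≥0∞) :
    volume {t : ℝ | 0 ≤ t ∧ ENNReal.ofReal t < a} = a := by
  rcases eq_or_ne a ∞ with rfl | ha
  · have : {t : ℝ | 0 ≤ t ∧ ENNReal.ofReal t < ∞} = Ici 0 := by
      ext t; simp
    rw [this, Real.volume_Ici]
  · have : {t : ℝ | 0 ≤ t ∧ ENNReal.ofReal t < a} = Ico 0 a.toReal := by
      ext t
      simp only [mem_ofPred_eq, mem_Ico]
      exact and_congr_right fun ht => ENNReal.ofReal_lt_iff_lt_toReal ht ha
    rw [this, Real.volume_Ico, sub_zero, ENNReal.ofReal_toReal ha]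

theorem prod_subgraph_inter_preimage (lam : Measure X) [SFinite lam] {f : X → ℝ≥0∞}
    (hf : Measurable f) {B : Set X} (hB : MeasurableSet B) :
    (lam.prod volume) (subgraph f ∩ Prod.fst ⁻¹' B) = lam.withDensity f B := by
  rw [Measure.prod_apply ((measurableSet_subgraph hf).inter (measurable_fst hB)),
    withDensity_apply _ hB, ← lintegral_indicator hB]
  congr 1 with x
  by_cases hx : x ∈ B
  · rw [indicator_of_mem hx]
    convert volume_setOf_ofReal_lt (f x) using 2
    ext t; simp [subgraph, hx]
  · rw [indicator_of_notMem hx]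
    convert measure_empty (μ := volume) using 2
    ext t; simp [hx]

end Subgraph

/-! ### The Maharam extension -/

section Maharam

variable {X : Type*} [MeasurableSpace X]

/-- The Maharam extension of `e` to `X × ℝ`: the second coordinate is rescaled so that `lam × dt`
is preserved when `lam` is quasi-invariant under `e`. -/
noncomputable def maharam (lam : Measure X) (e : X ≃ᵐ X) (p : X × ℝ) : X × ℝ :=
  (e p.1, p.2 * ((lam.map e.symm).rnDeriv lam p.1).toReal⁻¹)

theorem measurable_maharam (lam : Measure X) (e : X ≃ᵐ X) : Measurable (maharam lam e) :=
  (e.measurable.comp measurable_fst).prodMk (measurable_snd.mul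
    ((Measure.measurable_rnDeriv _ _).ennreal_toReal.inv.comp measurable_fst))

theorem ae_rnDeriv_pos_and_ne_top (lam : Measure X) [IsFiniteMeasure lam] (e : X ≃ᵐ X)
    (h1 : lam.map e.symm ≪ lam) (h2 : lam ≪ lam.map e.symm) :
    ∀ᵐ x ∂lam, 0 < (lam.map e.symm).rnDeriv lam x ∧ (lam.map e.symm).rnDeriv lam x ≠ ∞ := by
  filter_upwards [h2.ae_le (Measure.rnDeriv_pos h1), (lam.map e.symm).rnDeriv_lt_top lam]
    with x hx hx' using ⟨hx, hx'.ne⟩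

/-- Rescaling a fibre by the inverse Radon–Nikodym derivative multiplies the length of its preimages
by that derivative, which is exactly the change of variables on the base. -/
theorem measurePreserving_maharam (lam : Measure X) [IsFiniteMeasure lam] (e : X ≃ᵐ X)
    (h1 : lam.map e.symm ≪ lam) (h2 : lam ≪ lam.map e.symm) :
    MeasurePreserving (maharam lam e) (lam.prod volume) (lam.prod volume) := by
  refine ⟨measurable_maharam lam e, ?_⟩
  ext S hS
  have hm : Measurable fun x => volume (Prod.mk x ⁻¹' S : Set ℝ) := measurable_measure_prodMk_left hS
  rw [Measure.map_apply (measurable_maharam lam e) hS,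
    Measure.prod_apply (measurable_maharam lam e hS), Measure.prod_apply hS]
  calc _ = ∫⁻ x, (lam.map e.symm).rnDeriv lam x * volume (Prod.mk (e x) ⁻¹' S : Set ℝ) ∂lam := by
        apply lintegral_congr_ae
        filter_upwards [ae_rnDeriv_pos_and_ne_top lam e h1 h2] with x hx
        have hw : 0 < ((lam.map e.symm).rnDeriv lam x).toReal :=
          ENNReal.toReal_pos hx.1.ne' hx.2
        have := Real.volume_preimage_mul_right (inv_ne_zero hw.ne') (Prod.mk (e x) ⁻¹' S)
        rw [inv_inv, abs_of_pos hw, ENNReal.ofReal_toReal hx.2] at this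
        exact this
    _ = ∫⁻ x, volume (Prod.mk (e x) ⁻¹' S : Set ℝ) ∂(lam.map e.symm) :=
        lintegral_rnDeriv_mul h1 (hm.comp e.measurable).aemeasurable
    _ = _ := by
        rw [lintegral_map (f := fun x => volume (Prod.mk (e x) ⁻¹' S : Set ℝ))
          (hm.comp e.measurable) e.symm.measurable]
        simp

theorem rnDeriv_map_symm_mul_comp (lam : Measure X) [IsFiniteMeasure lam] (e : X ≃ᵐ X)
    (h1 : lam.map e.symm ≪ lam) (ρ : Measure X) [IsFiniteMeasure ρ] (hρ : ρ ≪ lam) :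
    (fun x => (lam.map e.symm).rnDeriv lam x * ρ.rnDeriv lam (e x)) =ᵐ[lam]
      (ρ.map e.symm).rnDeriv lam := by
  have hac : ρ.map e.symm ≪ lam := (hρ.map e.symm.measurable).trans h1
  have hmeas : Measurable fun x => ρ.rnDeriv lam (e x) :=
    (Measure.measurable_rnDeriv ρ lam).comp e.measurable
  have hwm : Measurable ((lam.map e.symm).rnDeriv lam) := Measure.measurable_rnDeriv _ _
  refine ((withDensity_eq_iff (Measure.measurable_rnDeriv _ _).aemeasurable
    (hwm.mul hmeas).aemeasurable (Measure.lintegral_rnDeriv_lt_top _ _).ne).1 ?_).symm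
  rw [Measure.withDensity_rnDeriv_eq _ _ hac]
  ext s hs
  rw [withDensity_apply _ hs]
  simp only [Pi.mul_apply]
  rw [setLIntegral_rnDeriv_mul h1 hmeas.aemeasurable hs,
    Measure.restrict_map e.symm.measurable hs, lintegral_map hmeas e.symm.measurable,
    Measure.map_apply e.symm.measurable hs]
  simp only [MeasurableEquiv.apply_symm_apply]
  exact (Measure.setLIntegral_rnDeriv hρ _).symm

/-- The Maharam extension pulls the subgraph of the density of `ρ` back to the subgraph of the
density of `ρ.map e.symm`. -/
theorem maharam_preimage_subgraph (lam : Measure X) [IsFiniteMeasure lam] (e : X ≃ᵐ X)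
    (h1 : lam.map e.symm ≪ lam) (h2 : lam ≪ lam.map e.symm) (ρ : Measure X) [IsFiniteMeasure ρ]
    (hρ : ρ ≪ lam) :
    (maharam lam e ⁻¹' subgraph (ρ.rnDeriv lam) : Set (X × ℝ)) =ᵐ[lam.prod volume]
      subgraph ((ρ.map e.symm).rnDeriv lam) := by
  have h := (ae_rnDeriv_pos_and_ne_top lam e h1 h2).and (rnDeriv_map_symm_mul_comp lam e h1 ρ hρ)
  filter_upwards [Measure.quasiMeasurePreserving_fst.ae h] with ⟨x, t⟩ ⟨⟨hpos, htop⟩, hx⟩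
  have hw : 0 < ((lam.map e.symm).rnDeriv lam x).toReal := ENNReal.toReal_pos hpos.ne' htop
  apply propext
  change (0 ≤ t * ((lam.map e.symm).rnDeriv lam x).toReal⁻¹ ∧
      ENNReal.ofReal (t * ((lam.map e.symm).rnDeriv lam x).toReal⁻¹) < ρ.rnDeriv lam (e x)) ↔
    (0 ≤ t ∧ ENNReal.ofReal t < (ρ.map e.symm).rnDeriv lam x)
  rw [mul_nonneg_iff_of_pos_right (inv_pos.2 hw), ← hx]
  refine and_congr_right fun ht => ?_
  rw [← div_eq_mul_inv, ENNReal.ofReal_div_of_pos hw, ENNReal.ofReal_toReal htop,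
    ENNReal.div_lt_iff (Or.inl hpos.ne') (Or.inl htop), mul_comm]

end Maharam

/-! ### Symmetric differences of subgraphs -/

section Densities

theorem subgraph_mono_on {X : Type*} {f g : X → ℝ≥0∞} {B : Set X} (h : ∀ x ∈ B, f x ≤ g x) :
    subgraph f ∩ Prod.fst ⁻¹' B ⊆ subgraph g ∩ Prod.fst ⁻¹' B :=
  fun _ hp => ⟨⟨hp.1.1, hp.1.2.trans_le (h _ hp.2)⟩, hp.2⟩

variable {X : Type*} [MeasurableSpace X]

theorem prod_subgraph_rnDeriv_inter_preimage {lam ρ : Measure X} [IsFiniteMeasure lam]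
    [IsFiniteMeasure ρ] (hρ : ρ ≪ lam) {B : Set X} (hB : MeasurableSet B) :
    (lam.prod volume) (subgraph (ρ.rnDeriv lam) ∩ Prod.fst ⁻¹' B) = ρ B := by
  rw [prod_subgraph_inter_preimage lam (Measure.measurable_rnDeriv _ _) hB,
    Measure.withDensity_rnDeriv_eq _ _ hρ]

theorem prod_subgraph_rnDeriv {lam ρ : Measure X} [IsFiniteMeasure lam]
    [IsFiniteMeasure ρ] (hρ : ρ ≪ lam) :
    (lam.prod volume) (subgraph (ρ.rnDeriv lam)) = ρ univ := by
  simpa using prod_subgraph_rnDeriv_inter_preimage hρ MeasurableSet.univ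

theorem measure_subgraph_diff {lam ρ σ : Measure X} [IsFiniteMeasure lam]
    [IsFiniteMeasure ρ] [IsFiniteMeasure σ] (hρ : ρ ≪ lam) (hσ : σ ≪ lam) {B : Set X}
    (hB : MeasurableSet B) (h : ∀ x ∈ B, σ.rnDeriv lam x ≤ ρ.rnDeriv lam x)
    (h' : ∀ x ∈ Bᶜ, ρ.rnDeriv lam x ≤ σ.rnDeriv lam x) :
    (lam.prod volume) (subgraph (ρ.rnDeriv lam) \ subgraph (σ.rnDeriv lam)) =
      ENNReal.ofReal (ρ.real B - σ.real B) := by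
  have e : subgraph (ρ.rnDeriv lam) \ subgraph (σ.rnDeriv lam) =
      (subgraph (ρ.rnDeriv lam) ∩ Prod.fst ⁻¹' B) \ (subgraph (σ.rnDeriv lam) ∩ Prod.fst ⁻¹' B) := by
    ext p
    constructor
    · rintro ⟨hp, hp'⟩
      have hpB : p.1 ∈ B := by
        by_contra hn
        exact hp' (subgraph_mono_on h' ⟨hp, hn⟩).1
      exact ⟨⟨hp, hpB⟩, fun q => hp' q.1⟩
    · rintro ⟨⟨hp, hpB⟩, hp'⟩
      exact ⟨hp, fun q => hp' ⟨q, hpB⟩⟩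
  rw [e, measure_sdiff (subgraph_mono_on h)
    ((measurableSet_subgraph (Measure.measurable_rnDeriv _ _)).inter
      (measurable_fst hB)).nullMeasurableSet
    (by rw [prod_subgraph_rnDeriv_inter_preimage hσ hB]; exact measure_ne_top _ _),
    prod_subgraph_rnDeriv_inter_preimage hσ hB, prod_subgraph_rnDeriv_inter_preimage hρ hB,
    ENNReal.ofReal_sub _ measureReal_nonneg, ofReal_measureReal, ofReal_measureReal]

/-- The subgraphs of the densities of `ρ` and `σ` differ by at most `‖ρ - σ‖` in measure. -/
theorem measure_subgraph_diff_add_le {lam ρ σ : Measure X} [IsFiniteMeasure lam]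
    [IsFiniteMeasure ρ] [IsFiniteMeasure σ] (hρ : ρ ≪ lam) (hσ : σ ≪ lam) :
    (lam.prod volume) (subgraph (ρ.rnDeriv lam) \ subgraph (σ.rnDeriv lam)) +
      (lam.prod volume) (subgraph (σ.rnDeriv lam) \ subgraph (ρ.rnDeriv lam)) ≤
      ENNReal.ofReal (tvNorm (ρ.toSignedMeasure - σ.toSignedMeasure)) := by
  let B : Set X := {x | σ.rnDeriv lam x ≤ ρ.rnDeriv lam x}
  have hB : MeasurableSet B :=
    measurableSet_le (Measure.measurable_rnDeriv _ _) (Measure.measurable_rnDeriv _ _)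
  have h : ∀ x ∈ B, σ.rnDeriv lam x ≤ ρ.rnDeriv lam x := fun x hx => hx
  have h' : ∀ x ∈ Bᶜ, ρ.rnDeriv lam x ≤ σ.rnDeriv lam x := fun x hx =>
    (le_total _ _).resolve_left hx
  have hle : ∀ {a b : Measure X} {C : Set X} [IsFiniteMeasure a] [IsFiniteMeasure b],
      a ≪ lam → b ≪ lam → MeasurableSet C → (∀ x ∈ C, a.rnDeriv lam x ≤ b.rnDeriv lam x) →
      0 ≤ b.real C - a.real C := by
    intro a b C _ _ ha hb hC hab
    refine sub_nonneg.2 (ENNReal.toReal_mono (measure_ne_top _ _) ?_)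
    rw [← prod_subgraph_rnDeriv_inter_preimage ha hC, ← prod_subgraph_rnDeriv_inter_preimage hb hC]
    exact measure_mono (subgraph_mono_on hab)
  rw [measure_subgraph_diff hρ hσ hB h h',
    measure_subgraph_diff hσ hρ hB.compl h' (by rwa [compl_compl]),
    ← ENNReal.ofReal_add (hle hσ hρ hB h) (hle hρ hσ hB.compl h')]
  exact ENNReal.ofReal_le_ofReal (sub_add_sub_compl_le_tvNorm ρ σ hB)

end Densities

theorem eLpNorm_one_indicatorConstLp_sub_le {Y : Type*} [MeasurableSpace Y] {m : Measure Y}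
    {A B : Set Y} (hA : MeasurableSet A) (hB : MeasurableSet B) (hmA : m A ≠ ∞) (hmB : m B ≠ ∞) :
    eLpNorm (indicatorConstLp 2 hA hmA (1 : ℝ) - indicatorConstLp 2 hB hmB (1 : ℝ) : Lp ℝ 2 m) 1 m
      ≤ m (A \ B) + m (B \ A) := by
  rw [eLpNorm_one_eq_lintegral_enorm, ← lintegral_indicator_one (hA.diff hB),
    ← lintegral_indicator_one (hB.diff hA),
    ← lintegral_add_left (measurable_one.indicator (hA.diff hB))]
  apply lintegral_mono_ae
  filter_upwards [Lp.coeFn_sub (indicatorConstLp 2 hA hmA (1 : ℝ)) (indicatorConstLp 2 hB hmB 1),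
    indicatorConstLp_coeFn (p := 2) (hs := hA) (hμs := hmA) (c := (1 : ℝ)),
    indicatorConstLp_coeFn (p := 2) (hs := hB) (hμs := hmB) (c := (1 : ℝ))] with y h1 h2 h3
  rw [h1, Pi.sub_apply, h2, h3]
  by_cases ha : y ∈ A <;> by_cases hb : y ∈ B <;> simp [ha, hb]

/-! ### Projecting densities back to the base -/

section Pushforward

variable {X Y : Type*} [MeasurableSpace X] [MeasurableSpace Y]

theorem measureReal_map_withDensity_ofReal {m : Measure Y} {p : Y → X} (hp : Measurable p)
    {u : Y → ℝ} (hu : Integrable u m) (h0 : ∀ y, 0 ≤ u y) {i : Set X} (hi : MeasurableSet i) :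
    ((m.withDensity fun y => ENNReal.ofReal (u y)).map p).real i = ∫ y in p ⁻¹' i, u y ∂m := by
  rw [measureReal_def, Measure.map_apply hp hi, withDensity_apply _ (hp hi),
    integral_eq_lintegral_of_nonneg_ae (Eventually.of_forall h0) hu.aestronglyMeasurable.restrict]

theorem tvNorm_map_withDensity_sub_le {m : Measure Y} {p : Y → X} (hp : Measurable p)
    {u v : Y → ℝ} (hu : Integrable u m) (hv : Integrable v m) (hu0 : ∀ y, 0 ≤ u y)
    (hv0 : ∀ y, 0 ≤ v y) {μ ν : Measure X} [IsFiniteMeasure μ] [IsFiniteMeasure ν]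
    (hμ : μ = (m.withDensity fun y => ENNReal.ofReal (u y)).map p)
    (hν : ν = (m.withDensity fun y => ENNReal.ofReal (v y)).map p) :
    tvNorm (μ.toSignedMeasure - ν.toSignedMeasure) ≤ ∫ y, |u y - v y| ∂m := by
  refine tvNorm_sub_le fun i hi => ?_
  rw [hμ, hν, measureReal_map_withDensity_ofReal hp hu hu0 hi,
    measureReal_map_withDensity_ofReal hp hv hv0 hi,
    measureReal_map_withDensity_ofReal hp hu hu0 hi.compl,
    measureReal_map_withDensity_ofReal hp hv hv0 hi.compl,
    ← integral_sub hu.integrableOn hv.integrableOn, ← integral_sub hv.integrableOn hu.integrableOn,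
    ← integral_add_compl (f := fun y => |u y - v y|) (hp hi) (hu.sub hv).abs]
  refine add_le_add (integral_mono (hu.sub hv).integrableOn (hu.sub hv).abs.integrableOn
    fun y => le_abs_self _) (integral_mono (hv.sub hu).integrableOn (hu.sub hv).abs.integrableOn
    fun y => ?_)
  rw [abs_sub_comm]
  exact le_abs_self _

end Pushforward

theorem map_withDensity_of_comp_ae_eq {Y : Type*} [MeasurableSpace Y] {m : Measure Y} {T : Y → Y}
    (hT : MeasurePreserving T m m) {f : Y → ℝ≥0∞} (hf : Measurable f) (h : f ∘ T =ᵐ[m] f) :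
    (m.withDensity f).map T = m.withDensity f := by
  ext S hS
  rw [Measure.map_apply hT.measurable hS, withDensity_apply _ (hT.measurable hS),
    withDensity_apply _ hS, ← hT.setLIntegral_comp_preimage hS hf]
  exact setLIntegral_congr_fun_ae (hT.measurable hS) (h.mono fun y hy _ => hy.symm)

/-! ### Countable groups -/

/-- A finite measure dominating all translates of `α` whose measure class is invariant. -/
theorem exists_quasiInvariant_dominating {G X : Type*} [Group G] [Countable G] [MeasurableSpace X]
    [MulAction G X] [MeasurableConstSMul G X] (α : Measure X) [IsProbabilityMeasure α] :
    ∃ lam : Measure X, IsFiniteMeasure lam ∧ (∀ g : G, α.map (g • ·) ≪ lam) ∧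
      ∀ g : G, lam.map (g • ·) ≪ lam := by
  obtain ⟨ε, hε, hsum⟩ := ENNReal.exists_pos_sum_of_countable one_ne_zero G
  let lam : Measure X := Measure.sum fun g : G => (ε g : ℝ≥0∞) • α.map (g • ·)
  have hnull : ∀ S, MeasurableSet S → (lam S = 0 ↔ ∀ g : G, α ((g • ·) ⁻¹' S) = 0) := by
    intro S hS
    rw [Measure.sum_apply_eq_zero' hS]
    refine forall_congr' fun g => ?_
    rw [Measure.smul_apply, Measure.map_apply (measurable_const_smul g) hS, smul_eq_mul,
      mul_eq_zero]
    simp [(hε g).ne']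
  refine ⟨lam, ⟨?_⟩, fun g => Measure.AbsolutelyContinuous.mk fun S hS h => ?_,
    fun g => Measure.AbsolutelyContinuous.mk fun S hS h => ?_⟩
  · rw [Measure.sum_apply _ MeasurableSet.univ]
    refine lt_of_le_of_lt (ENNReal.tsum_le_tsum fun g => ?_) (hsum.trans ENNReal.one_lt_top)
    rw [Measure.smul_apply, Measure.map_apply (measurable_const_smul g) MeasurableSet.univ]
    simp
  · rw [Measure.map_apply (measurable_const_smul g) hS]
    exact (hnull S hS).1 h g
  · rw [Measure.map_apply (measurable_const_smul g) hS, hnull _ (measurable_const_smul g hS)]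
    intro k
    simpa only [preimage_preimage, smul_smul] using (hnull S hS).1 h (g * k)

/-- If all translates of a probability measure under a countable group are within `r` of it, there
is an invariant measure within `r` of it. -/
theorem exists_invariant_measure_of_countable {G X : Type*} [Group G] [Countable G]
    [MeasurableSpace X] [MulAction G X] [MeasurableConstSMul G X] (α : Measure X)
    [IsProbabilityMeasure α] {r : ℝ} (hr : 0 ≤ r)
    (hα : ∀ g : G, tvNorm ((α.map (g • ·)).toSignedMeasure - α.toSignedMeasure) ≤ r) :
    ∃ (μ : Measure X) (_ : IsFiniteMeasure μ), (∀ g : G, μ.map (g • ·) = μ) ∧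
      tvNorm (α.toSignedMeasure - μ.toSignedMeasure) ≤ r := by
  obtain ⟨lam, _, hac, hquasi⟩ := exists_quasiInvariant_dominating (G := G) α
  have hα1 : α.map ((1 : G) • ·) = α := by simp
  let e : G → X ≃ᵐ X := fun g => MeasurableEquiv.smul g
  have he : ∀ g, ⇑(e g).symm = (g⁻¹ • ·) := fun g => rfl
  have hq1 : ∀ g, lam.map (e g).symm ≪ lam := fun g => hquasi g⁻¹
  -- Pushing `g lam ≪ lam` forward by `g⁻¹` gives the reverse absolute continuity.
  have hq2 : ∀ g, lam ≪ lam.map (e g).symm := fun g => by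
    have h := (hquasi g).map (e g).symm.measurable
    rw [Measure.map_map (e g).symm.measurable (measurable_const_smul g)] at h
    have : ⇑(e g).symm ∘ (g • ·) = id := by ext x; simp [he]
    rwa [this, Measure.map_id] at h
  let m : Measure (X × ℝ) := lam.prod volume
  let A : G → Set (X × ℝ) := fun g => subgraph ((α.map (g • ·)).rnDeriv lam)
  have hfin : ∀ g : G, IsProbabilityMeasure (α.map (g • ·)) := fun g =>
    Measure.isProbabilityMeasure_map (measurable_const_smul g).aemeasurable
  have hA : ∀ g, MeasurableSet (A g) := fun g =>
    measurableSet_subgraph (Measure.measurable_rnDeriv _ _)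
  have hmA : ∀ g, m (A g) ≠ ∞ := fun g => by
    rw [prod_subgraph_rnDeriv (hac g)]; exact measure_ne_top _ _
  let u : G → Lp ℝ 2 m := fun g => indicatorConstLp 2 (hA g) (hmA g) 1
  obtain ⟨c, hc, hfix⟩ := exists_mem_closure_convexHull_fixed (range_nonempty u)
  have hT : ∀ g, MeasurePreserving (maharam lam (e g)) m m := fun g =>
    measurePreserving_maharam lam (e g) (hq1 g) (hq2 g)
  have hcT : ∀ g, (c : X × ℝ → ℝ) ∘ maharam lam (e g) =ᵐ[m] c := fun g => by
    have hfixg := hfix (Lp.compMeasurePreservingₗᵢ ℝ (maharam lam (e g)) (hT g)) <| by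
      rintro _ ⟨k, rfl⟩
      refine ⟨g⁻¹ * k, ?_⟩
      have hmap : (α.map (k • ·)).map (e g).symm = α.map ((g⁻¹ * k) • ·) := by
        rw [Measure.map_map (e g).symm.measurable (measurable_const_smul k)]
        congr 1
        ext x
        simp [he, mul_smul]
      have hpre := maharam_preimage_subgraph lam (e g) (hq1 g) (hq2 g) (α.map (k • ·)) (hac k)
      rw [hmap] at hpre
      refine Lp.ext ?_
      have h1 := Lp.coeFn_compMeasurePreserving (u k) (hT g)
      have h2 := (hT g).quasiMeasurePreserving.ae
        (indicatorConstLp_coeFn (p := 2) (hs := hA k) (hμs := hmA k) (c := (1 : ℝ)))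
      have h3 := indicatorConstLp_coeFn (p := 2) (hs := hA (g⁻¹ * k)) (hμs := hmA (g⁻¹ * k))
        (c := (1 : ℝ))
      filter_upwards [h1, h2, h3, hpre.mem_iff] with y h1 h2 h3 h4
      refine h3.trans (Eq.trans ?_ h1.symm)
      refine Eq.trans ?_ h2.symm
      by_cases hy : y ∈ A (g⁻¹ * k)
      · have hy' : maharam lam (e g) y ∈ A k := h4.2 hy
        rw [indicator_of_mem hy, indicator_of_mem hy']
      · have hy' : maharam lam (e g) y ∉ A k := fun h => hy (h4.1 h)
        rw [indicator_of_notMem hy, indicator_of_notMem hy']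
    have h := Lp.coeFn_compMeasurePreserving c (hT g)
    have h' : Lp.compMeasurePreserving (maharam lam (e g)) (hT g) c = c := hfixg
    rw [h'] at h
    exact h.symm
  have hdist : eLpNorm (c - u 1 : Lp ℝ 2 m) 1 m ≤ ENNReal.ofReal r := by
    refine eLpNorm_one_sub_le_of_mem_closure_convexHull ?_ hc
    rintro _ ⟨g, rfl⟩
    refine (eLpNorm_one_indicatorConstLp_sub_le _ _ _ _).trans ?_
    refine (measure_subgraph_diff_add_le (hac g) (hac 1)).trans (ENNReal.ofReal_le_ofReal ?_)
    convert hα g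
  let a : X × ℝ → ℝ := (A 1).indicator 1
  have hcm : Measurable c := (Lp.stronglyMeasurable c).measurable
  have hint_a : Integrable a m := (integrable_indicator_iff (hA 1)).2
    (integrableOn_const (hmA 1))
  have hsub : (c - u 1 : Lp ℝ 2 m) =ᵐ[m] fun y => c y - a y := by
    filter_upwards [Lp.coeFn_sub c (u 1),
      indicatorConstLp_coeFn (p := 2) (hs := hA 1) (hμs := hmA 1) (c := (1 : ℝ))] with y h1 h2
    rw [h1, Pi.sub_apply]
    exact congrArg _ h2
  rw [eLpNorm_congr_ae hsub] at hdist
  -- Since `m` is infinite in general, `c ∈ L²` need not be integrable; integrability comes from the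
  -- `L¹` distance to `a`.
  have hint_sub : Integrable (fun y => c y - a y) m :=
    memLp_one_iff_integrable.1 ⟨(hcm.aestronglyMeasurable.sub hint_a.aestronglyMeasurable),
      hdist.trans_lt ENNReal.ofReal_lt_top⟩
  have hint_c : Integrable c m := (hint_sub.add hint_a).congr (Eventually.of_forall fun y => by simp)
  -- The positive part keeps the invariance and, as `a ≥ 0`, does not increase the distance to `a`.
  let b : X × ℝ → ℝ := fun y => max (c y) 0
  have hint_b : Integrable b m := hint_c.pos_part
  have ha0 : ∀ y, 0 ≤ a y := fun y => indicator_nonneg (fun _ _ => zero_le_one) y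
  have hb0 : ∀ y, 0 ≤ b y := fun y => le_max_right _ _
  have hbm : Measurable fun y => ENNReal.ofReal (b y) := (hcm.max measurable_const).ennreal_ofReal
  let μ : Measure X := (m.withDensity fun y => ENNReal.ofReal (b y)).map Prod.fst
  have hfinb : IsFiniteMeasure (m.withDensity fun y => ENNReal.ofReal (b y)) :=
    isFiniteMeasure_withDensity_ofReal hint_b.2
  have hμ : IsFiniteMeasure μ := inferInstance
  refine ⟨μ, hμ, fun g => ?_, ?_⟩
  · have hinv := map_withDensity_of_comp_ae_eq (hT g) hbm <| by
      filter_upwards [hcT g] with y hy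
      simp only [Function.comp_apply] at hy
      simp only [b, Function.comp_apply, hy]
    -- The first projection intertwines the Maharam extension with the action of `g`.
    change Measure.map _ (Measure.map _ _) = Measure.map _ _
    conv_rhs => rw [← hinv]
    rw [Measure.map_map (measurable_const_smul g) measurable_fst,
      Measure.map_map measurable_fst (hT g).measurable]
    rfl
  · have hα' : α = (m.withDensity fun y => ENNReal.ofReal (a y)).map Prod.fst := by
      have : (fun y => ENNReal.ofReal (a y)) = (A 1).indicator 1 := by
        ext y
        by_cases hy : y ∈ A 1 <;> simp [a, hy]
      ext B hB
      rw [this, withDensity_indicator_one (hA 1), Measure.map_apply measurable_fst hB,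
        Measure.restrict_apply (measurable_fst hB), inter_comm,
        prod_subgraph_rnDeriv_inter_preimage (hac 1) hB, hα1]
    refine (tvNorm_map_withDensity_sub_le measurable_fst hint_a hint_b ha0 hb0 hα' rfl).trans ?_
    calc ∫ y, |a y - b y| ∂m ≤ ∫ y, ‖c y - a y‖ ∂m := by
          refine integral_mono (hint_a.sub hint_b).abs hint_sub.norm fun y => ?_
          have := abs_max_sub_max_le_abs (c y) (a y) 0
          rw [max_eq_left (ha0 y)] at this
          rw [abs_sub_comm]
          exact this
      _ = (eLpNorm (fun y => c y - a y) 1 m).toReal := by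
          rw [eLpNorm_one_eq_lintegral_enorm, integral_norm_eq_lintegral_enorm hint_sub.1]
      _ ≤ r := ENNReal.toReal_le_of_le_ofReal hr hdist

/-! ### From a countable subgroup to the whole group -/

section Density

variable {G X : Type*} [Group G] [MetricSpace X] [CompactSpace X] [MulAction G X]
  [ContinuousConstSMul G X]

/-- The homeomorphism `x ↦ g • x` as an element of `C(X, X)`. -/
def smulContinuousMap (X : Type*) [TopologicalSpace X] [MulAction G X] [ContinuousConstSMul G X]
    (g : G) : C(X, X) := ⟨(g • ·), continuous_const_smul g⟩

variable (G X) in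
theorem exists_countable_subgroup_dense :
    ∃ H : Subgroup G, Countable H ∧
      ∀ g : G, smulContinuousMap X g ∈ closure (smulContinuousMap X '' (H : Set G)) := by
  obtain ⟨t, ht, htc, hdense⟩ :=
    (TopologicalSpace.IsSeparable.of_separableSpace
      (range (smulContinuousMap (G := G) X))).exists_countable_dense_subset
  choose s hs using fun y : t => ht y.2
  have : Countable t := htc
  refine ⟨(FreeGroup.lift s).range, (countable_range (FreeGroup.lift s)).to_subtype, fun g => ?_⟩
  refine closure_mono (fun y hy => ?_) (hdense (mem_range_self g))
  exact ⟨s ⟨y, hy⟩, ⟨FreeGroup.of ⟨y, hy⟩, FreeGroup.lift_apply_of⟩, hs ⟨y, hy⟩⟩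

/-- Bounded continuous functions determine finite measures, and each test integral depends
continuously on `f` by dominated convergence. -/
theorem isClosed_setOf_map_eq [MeasurableSpace X] [BorelSpace X] (μ : Measure X)
    [IsFiniteMeasure μ] : IsClosed {f : C(X, X) | μ.map f = μ} := by
  have : {f : C(X, X) | μ.map f = μ} =
      ⋂ φ : BoundedContinuousFunction X ℝ, {f | ∫ x, φ (f x) ∂μ = ∫ x, φ x ∂μ} := by
    ext f
    have hmap : ∀ φ : BoundedContinuousFunction X ℝ, ∫ x, φ x ∂(μ.map f) = ∫ x, φ (f x) ∂μ :=
      fun φ => integral_map f.continuous.aemeasurable φ.continuous.aestronglyMeasurable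
    simp only [mem_iInter]
    refine ⟨fun h φ => ?_, fun h => ext_of_forall_integral_eq_of_IsFiniteMeasure fun φ => ?_⟩
    · exact (hmap φ).symm.trans (congrArg (fun ν => ∫ x, φ x ∂ν) h)
    · exact (hmap φ).trans (h φ)
  rw [this]
  refine isClosed_iInter fun φ => isClosed_eq ?_ continuous_const
  refine continuous_of_dominated (bound := fun _ => ‖φ‖)
    (fun f => (φ.continuous.comp f.continuous).aestronglyMeasurable)
    (fun f => Eventually.of_forall fun x => φ.norm_coe_le_norm _) (integrable_const _)
    (Eventually.of_forall fun x => φ.continuous.comp (continuous_eval_const x))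

end Density

theorem theorem3p2 {G X : Type*} [Group G]
    [MetricSpace X] [CompactSpace X] [MeasurableSpace X] [BorelSpace X]
    [MulAction G X] [ContinuousConstSMul G X]
    (α : MeasureTheory.Measure X) [MeasureTheory.IsProbabilityMeasure α]
    (δ : ℝ) (hδ0 : 0 < δ) (hδ1 : δ < 1)
    (hα : ∀ g : G,
      tvNorm ((α.map (fun x => g • x)).toSignedMeasure - α.toSignedMeasure) ≤ δ / 10) :
    ∃ (μ₀ : MeasureTheory.Measure X) (_ : MeasureTheory.IsFiniteMeasure μ₀),
      μ₀ ≠ 0 ∧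
      MeasureTheory.SMulInvariantMeasure G X μ₀ ∧
      tvNorm (α.toSignedMeasure - μ₀.toSignedMeasure) ≤ δ := by
  obtain ⟨H, _, hH⟩ := exists_countable_subgroup_dense G X
  obtain ⟨μ, hμ, hinv, hdist⟩ := exists_invariant_measure_of_countable (G := H) α
    (by positivity : 0 ≤ δ / 10) fun g => hα g
  have hle : tvNorm (α.toSignedMeasure - μ.toSignedMeasure) ≤ δ := hdist.trans (by linarith)
  refine ⟨μ, hμ, ?_, ?_, hle⟩
  · rintro rfl
    -- The zero measure is at distance at least `1 > δ` from `α`.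
    have h := (sub_add_sub_compl_le_tvNorm α 0 MeasurableSet.univ).trans hle
    simp only [probReal_univ, measureReal_zero_apply, compl_univ, measureReal_empty] at h
    linarith
  · refine ((smulInvariantMeasure_tfae G μ).out 0 5).2 fun g => ?_
    have hsub : smulContinuousMap X '' (H : Set G) ⊆ {f : C(X, X) | μ.map f = μ} := by
      rintro _ ⟨h, hh, rfl⟩
      exact hinv ⟨h, hh⟩
    exact closure_minimal hsub (isClosed_setOf_map_eq μ) (hH g)
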